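/- Let $\Bbbk$ be a field, $R=\Bbbk[x_0,\dots,x_n]$, $\mathfrak m=(x_0,\dots,x_n)$, and let $I\subset R$ be a nonzero proper monomial ideal. For $m\ge 0$ let $I^{(m)}=\bigcap_{P\in\operatorname{Ass}(R/I)}(R\cap I^mR_P)$ be the $m$-th symbolic power of $I$, and let $e$ be the big-height of $I$, i.e. the maximum of the heights of the associated primes of $I$. Let $$\mathcal Q=\bigcap_{P}\operatorname{conv}\{\mathbf a\in\mathbb N^{n+1} : \mathbf x^{\mathbf a}\in R\cap IR_P\}\subseteq\mathbb R^{n+1}$$ be the symbolic polyhedron of $I$, where $P$ runs over the associated primes of $I$ that are maximal with respect to inclusion among the associated primes. Put $\alpha(\mathcal Q)=\min\{a_0+\cdots+a_n : (a_0,\dots,a_n)\in\mathcal Q\}$ and, for a nonzero monomial ideal $J$, let $\beta(J)$ be the largest degree of a minimal monomial generator of $J$. Then these extrema exist for $\mathcal Q$ and for every $J=I^r$ with $r\ge 0$, $\alpha(\mathcal Q)>0$, and for all integers $r\ge 0$ and $m\ge\max\bigl(er,\ \beta(I^r)/\alpha(\mathcal Q)\bigr)$, the integer $\lceil\alpha(\mathcal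 Q)m\rceil-\beta(I^r)$ is nonnegative and $$I^{(m)}\subseteq \mathfrak m^{\lceil\alpha(\mathcal Q)m\rceil-\beta(I^r)}\,I^r.$$ -/

import Mathlib

namespace MonomialSymbolic

section General

variable {R : Type*} [CommRing R]

/-- The contraction `R ∩ J R_P` of the extension of `J` to the localization of `R` at the
prime `P`. -/
noncomputable def localContraction (J P : Ideal R) [P.IsPrime] : Ideal R :=
  (J.map (algebraMap R (Localization.AtPrime P))).comap
    (algebraMap R (Localization.AtPrime P))

/-- The `m`-th symbolic power `I^{(m)}`: the intersection of `R ∩ I^m R_P` over all the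
associated primes `P` of `I` (that is, of the module `R ⧸ I`). -/
noncomputable def symbolicPower (I : Ideal R) (m : ℕ) : Ideal R :=
  ⨅ P : associatedPrimes R (R ⧸ I), localContraction (I ^ m) P.1

/-- The set of the associated primes of `I` that are maximal with respect to inclusion among
the associated primes of `I`. -/
def maxAss (I : Ideal R) : Set (Ideal R) :=
  {P | Maximal (fun P' => P' ∈ associatedPrimes R (R ⧸ I)) P}

/-- The big-height of `I`: the maximum of the heights of its associated primes. -/
noncomputable def bigHeight (I : Ideal R) : ℕ∞ :=
  ⨆ P ∈ associatedPrimes R (R ⧸ I), P.height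

end General

section Monomial

variable {K : Type*} [Field K] {n : ℕ}

/-- A monomial ideal is an ideal generated by a set of monomials. -/
def IsMonomialIdeal (I : Ideal (MvPolynomial (Fin (n + 1)) K)) : Prop :=
  ∃ S : Set (Fin (n + 1) →₀ ℕ),
    I = Ideal.span ((fun a => MvPolynomial.monomial a (1 : K)) '' S)

/-- The exponent vectors of the monomials in `J`, as points of `ℝ^{n+1}`. -/
def latticePoints (J : Ideal (MvPolynomial (Fin (n + 1)) K)) : Set (Fin (n + 1) → ℝ) :=
  {v | ∃ a : Fin (n + 1) →₀ ℕ, MvPolynomial.monomial a (1 : K) ∈ J ∧ v = fun i => (a i : ℝ)}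

/-- The symbolic polyhedron of `I`: the intersection, over the maximal associated primes `P`
of `I`, of the convex hulls of the sets of exponent vectors of the monomials in
`R ∩ I R_P`. -/
noncomputable def symbolicPolyhedron (I : Ideal (MvPolynomial (Fin (n + 1)) K)) :
    Set (Fin (n + 1) → ℝ) :=
  ⋂ (P : associatedPrimes (MvPolynomial (Fin (n + 1)) K) (MvPolynomial (Fin (n + 1)) K ⧸ I))
    (_ : P.1 ∈ maxAss I), convexHull ℝ (latticePoints (localContraction I P.1))

/-- The values `a_0 + ⋯ + a_n` of the coordinate sum on a subset of `ℝ^{n+1}`. -/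
def coordSums (Q : Set (Fin (n + 1) → ℝ)) : Set ℝ :=
  (fun a => ∑ i, a i) '' Q

/-- `α(Q)`, the minimum of the coordinate sum on `Q`. -/
noncomputable def alpha (Q : Set (Fin (n + 1) → ℝ)) : ℝ :=
  sInf (coordSums Q)

/-- The degrees of the minimal monomial generators of the monomial ideal `J`, which are the
monomials in `J` that are minimal with respect to divisibility. -/
def minGenDegrees (J : Ideal (MvPolynomial (Fin (n + 1)) K)) : Set ℕ :=
  Finsupp.degree '' {a : Fin (n + 1) →₀ ℕ |
    Minimal (fun b => MvPolynomial.monomial b (1 : K) ∈ J) a}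

/-- `β(J)`, the largest degree of a minimal generator of the monomial ideal `J`. -/
noncomputable def beta (J : Ideal (MvPolynomial (Fin (n + 1)) K)) : ℕ :=
  sSup (minGenDegrees J)

end Monomial

end MonomialSymbolic

/-! All ideals involved are monomial, so it suffices to treat one monomial `x^a` in `I^{(m)}`. At
each associated prime `P`, on the variables of `P`, `a` dominates a sum of `m` exponents `b_j` of
generators of `I`. Averaging the `b_j` puts `a/m` in the symbolic polyhedron, so `deg a ≥ α(𝒬) m`
(`alpha_mul_le_degree`). Selecting a single `b_j` gives `x^a ∈ I^r`: `P` contains at most `e`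
variables, and Carathéodory's argument (`exists_le_card_mul_sum`) finds `b_j ≤ (e/m) a ≤ a/r` on
them. Hence `x^⌊a/r⌋` lies in `I` locally at every `P`, so it lies in `I`, and its `r`-th power
divides `x^a`. Finally, a minimal generator of `I^r` dividing `x^a` has degree at most `β(I^r)`, and
the cofactor supplies the power of `𝔪`. -/

namespace MonomialSymbolic

/-! ### Carathéodory-type selection lemma -/

section Linear

/-- A conic form of Carathéodory's argument: among nonnegative vectors of a space of dimension
`card κ`, with nonnegative weights of total at least one, some vector is bounded by `card κ` times
the weighted sum. -/
theorem exists_le_card_mul_sum {ι κ : Type*} [Fintype κ] (v : ι → κ → ℝ) (s : Finset ι)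
    (w : ι → ℝ) (hv : ∀ j ∈ s, ∀ i, 0 ≤ v j i) (hw : ∀ j ∈ s, 0 ≤ w j) (h1 : 1 ≤ ∑ j ∈ s, w j) :
    ∃ j ∈ s, ∀ i, v j i ≤ Fintype.card κ * ∑ l ∈ s, w l * v l i := by
  classical
  induction hk : s.card generalizing s w with
  | zero =>
    rw [Finset.card_eq_zero] at hk
    subst hk
    norm_num at h1
  | succ k ih =>
    have hsum : ∀ i, 0 ≤ ∑ l ∈ s, w l * v l i := fun i =>
      Finset.sum_nonneg fun l hl => mul_nonneg (hw l hl) (hv l hl i)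
    have hne : s.Nonempty := Finset.card_pos.mp (by omega)
    rcases le_or_gt s.card (Fintype.card κ) with hle | hlt
    · have hpos : (0 : ℝ) < s.card := by exact_mod_cast hne.card_pos
      -- With at most `card κ` vectors, some weight is at least the average, hence at least `1 /
      -- card κ`.
      obtain ⟨j, hj, hwj⟩ := Finset.exists_le_of_sum_le (f := fun _ => (1 : ℝ) / s.card) (g := w)
        hne (by simpa [hpos.ne'] using h1)
      refine ⟨j, hj, fun i => ?_⟩
      have h2 : (1 : ℝ) ≤ Fintype.card κ * w j := by
        have h3 : (1 : ℝ) ≤ s.card * w j := by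
          rwa [div_le_iff₀ hpos, mul_comm] at hwj
        have h4 : (s.card : ℝ) ≤ Fintype.card κ := by exact_mod_cast hle
        exact h3.trans (mul_le_mul_of_nonneg_right h4 (hw j hj))
      calc v j i ≤ Fintype.card κ * w j * v j i := le_mul_of_one_le_left (hv j hj i) h2
        _ = Fintype.card κ * (w j * v j i) := by ring
        _ ≤ _ := by
          gcongr
          exact Finset.single_le_sum (f := fun l => w l * v l i)
            (fun l hl => mul_nonneg (hw l hl) (hv l hl i)) hj
    · have hdep : ∃ c : ι → ℝ, (∑ j ∈ s, c j • v j = 0) ∧ ∃ j ∈ s, c j ≠ 0 := by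
        have hnl : ¬ LinearIndepOn ℝ v (s : Set ι) := fun h => by
          have := LinearIndependent.fintype_card_le_finrank h
          simp at this
          omega
        rw [linearIndepOn_finset_iff] at hnl
        push Not at hnl
        exact hnl
      -- The sign is chosen so that replacing `w` by `w - t c` with `t ≥ 0` does not lower the total
      -- weight.
      have hdep' : ∃ c : ι → ℝ, (∑ j ∈ s, c j • v j = 0) ∧ (∃ j ∈ s, c j ≠ 0) ∧
          ∑ j ∈ s, c j ≤ 0 := by
        obtain ⟨c, hc, j, hj, hcj⟩ := hdep
        rcases le_total (∑ j ∈ s, c j) 0 with h | h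
        · exact ⟨c, hc, ⟨j, hj, hcj⟩, h⟩
        · exact ⟨fun j => - c j, by simpa using hc, ⟨j, hj, by simpa using hcj⟩, by simpa using h⟩
      obtain ⟨c, hc, ⟨j₀, hj₀, hcj₀⟩, hcs⟩ := hdep'
      have hc' : ∀ i, ∑ j ∈ s, c j * v j i = 0 := fun i => by
        simpa using congrFun hc i
      by_cases hex : ∃ j ∈ s, 0 < c j
      · obtain ⟨j₁, hj₁, hcj₁⟩ := hex
        -- The minimal ratio `t` keeps `w - t c` nonnegative and kills the weight at `j`, so `j` can
        -- be dropped without changing the weighted sum.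
        obtain ⟨j, hj, hmin⟩ := Finset.exists_min_image (s.filter fun j => 0 < c j)
          (fun j => w j / c j) ⟨j₁, by simp [hj₁, hcj₁]⟩
        rw [Finset.mem_filter] at hj
        obtain ⟨hj, hcj⟩ := hj
        set t := w j / c j with ht
        have ht0 : 0 ≤ t := div_nonneg (hw j hj) hcj.le
        have hzero : w j - t * c j = 0 := by rw [ht]; field_simp; ring
        have hE : ∀ g : ι → ℝ, ∑ l ∈ s.erase j, (w l - t * c l) * g l
            = ∑ l ∈ s, w l * g l - t * ∑ l ∈ s, c l * g l := fun g => by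
          rw [Finset.sum_erase _ (by rw [hzero, zero_mul]), Finset.mul_sum,
            ← Finset.sum_sub_distrib]
          exact Finset.sum_congr rfl fun _ _ => by ring
        obtain ⟨l, hl, hlv⟩ := ih (s.erase j) (fun l => w l - t * c l)
          (fun l hl => hv l (Finset.mem_of_mem_erase hl))
          (fun l hl => by
            have hl' := Finset.mem_of_mem_erase hl
            rcases le_or_gt (c l) 0 with h | h
            · have := mul_nonneg ht0 (neg_nonneg.mpr h)
              have := hw l hl'
              linarith
            · have := hmin l (by simp [hl', h])
              rw [le_div_iff₀ h] at this
              linarith)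
          (by
            have := hE fun _ => 1
            simp only [mul_one] at this
            rw [this]
            have := mul_nonneg ht0 (neg_nonneg.mpr hcs)
            linarith)
          (by rw [Finset.card_erase_of_mem hj]; omega)
        refine ⟨l, Finset.mem_of_mem_erase hl, fun i => ?_⟩
        have := hlv i
        rwa [hE fun l => v l i, hc' i, mul_zero, sub_zero] at this
      -- All `c j ≤ 0` and all vectors are nonnegative, so every term of the relation vanishes and
      -- `v j₀ = 0`.
      · push Not at hex
        refine ⟨j₀, hj₀, fun i => ?_⟩
        have h0 := (Finset.sum_eq_zero_iff_of_nonpos fun j hj =>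
          mul_nonpos_of_nonpos_of_nonneg (hex j hj) (hv j hj i)).mp (hc' i) j₀ hj₀
        rw [(mul_eq_zero.mp h0).resolve_left hcj₀]
        exact mul_nonneg (Nat.cast_nonneg _) (hsum i)

end Linear

/-! ### Heights of primes containing variables -/

section Height

open MvPolynomial

variable {σ K : Type*} [Field K]

/-- The ideal is the kernel of the substitution `φ` killing the variables in `A`, whose target is a
domain; modulo the ideal, `φ` is the identity. -/
theorem isPrime_span_X_image (A : Set σ) :
    (Ideal.span (X '' A : Set (MvPolynomial σ K))).IsPrime := by
  classical
  set q := Ideal.span (X '' A : Set (MvPolynomial σ K))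
  let φ : MvPolynomial σ K →ₐ[K] MvPolynomial σ K := aeval fun i => if i ∈ A then 0 else X i
  have hφ : (Ideal.Quotient.mkₐ K q).comp φ = Ideal.Quotient.mkₐ K q := by
    ext i
    by_cases hi : i ∈ A
    · have : (Ideal.Quotient.mk q) (X i) = 0 :=
        Ideal.Quotient.eq_zero_iff_mem.mpr (Ideal.subset_span ⟨i, hi, rfl⟩)
      simp [φ, hi, this]
    · simp [φ, hi]
  have hker : q = RingHom.ker φ := by
    apply le_antisymm
    · rw [Ideal.span_le]
      rintro _ ⟨i, hi, rfl⟩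
      simp [φ, hi]
    · intro f hf
      rw [RingHom.mem_ker] at hf
      rw [← Ideal.Quotient.eq_zero_iff_mem]
      have := DFunLike.congr_fun hφ f
      simpa [hf] using this.symm
  rw [hker]
  exact RingHom.ker_isPrime _

/-- Adjoining the variables one at a time gives a strict chain of primes below `P`. -/
theorem card_le_height_of_X_mem (A : Finset σ) (P : Ideal (MvPolynomial σ K))
    (hA : ∀ i ∈ A, X i ∈ P) : (A.card : ℕ∞) ≤ P.height := by
  classical
  have key : (A.card : ℕ∞) ≤ (Ideal.span (X '' (A : Set σ) : Set (MvPolynomial σ K))).height := by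
    clear hA
    induction A using Finset.induction_on with
    | empty => simp
    | insert a A ha ih =>
      have := isPrime_span_X_image (K := K) (A : Set σ)
      have := isPrime_span_X_image (K := K) ((insert a A : Finset σ) : Set σ)
      have hlt : Ideal.span (X '' (A : Set σ) : Set (MvPolynomial σ K)) <
          Ideal.span (X '' ((insert a A : Finset σ) : Set σ)) := by
        refine lt_of_le_of_ne (Ideal.span_mono (Set.image_mono (by simp))) fun h => ?_
        have hmem : (X a : MvPolynomial σ K) ∈ Ideal.span (X '' (A : Set σ)) := by
          rw [h]
          exact Ideal.subset_span ⟨a, by simp, rfl⟩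
        rw [mem_ideal_span_X_image] at hmem
        obtain ⟨i, hi, hne⟩ := hmem (Finsupp.single a 1) (by simp [support_X])
        rw [Finsupp.single_apply] at hne
        split_ifs at hne with h'
        · exact ha (by rw [h']; exact_mod_cast hi)
        · exact hne rfl
      rw [Finset.card_insert_of_notMem ha, Nat.cast_succ]
      exact (add_le_add_left ih 1).trans (Ideal.height_add_one_le_of_lt_of_isPrime hlt)
  refine key.trans (Ideal.height_mono ?_)
  rw [Ideal.span_le]
  rintro _ ⟨i, hi, rfl⟩
  exact hA i hi

end Height

/-! ### Contractions from localizations -/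

section Contraction

variable {R : Type*} [CommRing R]

theorem mem_localContraction {J P : Ideal R} [P.IsPrime] {f : R} :
    f ∈ localContraction J P ↔ ∃ s ∉ P, s * f ∈ J := by
  rw [localContraction, Ideal.mem_comap,
    IsLocalization.algebraMap_mem_map_algebraMap_iff P.primeCompl]
  rfl

theorem le_localContraction (J P : Ideal R) [P.IsPrime] : J ≤ localContraction J P :=
  Ideal.le_comap_map

theorem localContraction_le {J P : Ideal R} [hP : P.IsPrime] (h : J ≤ P) :
    localContraction J P ≤ P := fun f hf => by
  obtain ⟨s, hs, hsf⟩ := mem_localContraction.mp hf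
  exact (hP.mem_or_mem (h hsf)).resolve_left hs

theorem le_of_mem_associatedPrimes {I P : Ideal R} (hP : P ∈ associatedPrimes R (R ⧸ I)) :
    I ≤ P := by
  have h := IsAssociatedPrime.annihilator_le hP
  rwa [Submodule.annihilator_top, Ideal.annihilator_quotient] at h

/-- If `f ∉ I`, the annihilator of its class in `R ⧸ I` lies in some associated prime `P`, so no `s
∉ P` satisfies `s f ∈ I`. -/
theorem mem_of_forall_mem_localContraction [IsNoetherianRing R] {I : Ideal R} {f : R}
    (h : ∀ P : associatedPrimes R (R ⧸ I),
      haveI : P.1.IsPrime := P.2.isPrime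
      f ∈ localContraction I P.1) : f ∈ I := by
  by_contra hf
  obtain ⟨P, hP, hle⟩ := exists_le_isAssociatedPrime_of_isNoetherianRing R
    (Ideal.Quotient.mk I f) (by rwa [Ne, Ideal.Quotient.eq_zero_iff_mem])
  have := hP.isPrime
  obtain ⟨s, hs, hsf⟩ := mem_localContraction.mp (h ⟨P, hP⟩)
  refine hs (hle ?_)
  rw [Submodule.mem_colon_singleton, Submodule.mem_bot, Algebra.smul_def]
  change Ideal.Quotient.mk I s * Ideal.Quotient.mk I f = 0
  rwa [← map_mul, Ideal.Quotient.eq_zero_iff_mem]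

end Contraction

/-! ### Monomial ideals and their contractions -/

section Monomials

open MvPolynomial

variable {σ K : Type*} [Field K]

theorem monomial_mem_of_le {J : Ideal (MvPolynomial σ K)} {a b : σ →₀ ℕ} (hab : a ≤ b)
    (ha : monomial a (1 : K) ∈ J) : monomial b (1 : K) ∈ J := by
  obtain ⟨c, rfl⟩ := exists_add_of_le hab
  have := J.mul_mem_left (monomial c 1) ha
  rwa [monomial_mul, one_mul, add_comm] at this

theorem mem_of_forall_monomial_mem {J : Ideal (MvPolynomial σ K)} {f : MvPolynomial σ K}
    (h : ∀ a ∈ f.support, monomial a (1 : K) ∈ J) : f ∈ J := by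
  rw [f.as_sum]
  refine J.sum_mem fun a ha => ?_
  have := J.mul_mem_left (C (coeff a f)) (h a ha)
  rwa [C_mul_monomial, mul_one] at this

/-- The monomials of the elements of a monomial ideal lie in the ideal. -/
theorem monomial_mem_span_of_mem_support {S : Set (σ →₀ ℕ)} {f : MvPolynomial σ K}
    (hf : f ∈ Ideal.span ((fun a => monomial a (1 : K)) '' S)) {a : σ →₀ ℕ} (ha : a ∈ f.support) :
    monomial a (1 : K) ∈ Ideal.span ((fun a => monomial a (1 : K)) '' S) := by
  obtain ⟨b, hb, hba⟩ := mem_ideal_span_monomial_image.mp hf a ha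
  exact monomial_mem_of_le hba (Ideal.subset_span ⟨b, hb, rfl⟩)

theorem span_monomial_pow (S : Set (σ →₀ ℕ)) (m : ℕ) :
    Ideal.span ((fun a => monomial a (1 : K)) '' S) ^ m =
      Ideal.span ((fun a => monomial a (1 : K)) ''
        {t | ∃ b : Fin m → σ →₀ ℕ, (∀ j, b j ∈ S) ∧ t = ∑ j, b j}) := by
  induction m with
  | zero =>
    have : (0 : σ →₀ ℕ) ∈ {t | ∃ b : Fin 0 → σ →₀ ℕ, (∀ j, b j ∈ S) ∧ t = ∑ j, b j} :=
      ⟨Fin.elim0, fun j => j.elim0, by simp⟩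
    rw [pow_zero, Ideal.one_eq_top, eq_comm, Ideal.eq_top_iff_one]
    exact Ideal.subset_span ⟨0, this, by simp⟩
  | succ m ih =>
    rw [pow_succ, ih, Ideal.span_mul_span']
    congr 1
    ext f
    simp only [Set.mem_mul, Set.mem_image, Set.mem_ofPred_eq]
    constructor
    · rintro ⟨_, ⟨_, ⟨b, hb, rfl⟩, rfl⟩, _, ⟨a, ha, rfl⟩, rfl⟩
      refine ⟨∑ j, b j + a, ⟨Fin.snoc (α := fun _ => σ →₀ ℕ) b a, fun j => ?_, ?_⟩, ?_⟩
      · refine Fin.lastCases ?_ (fun j => ?_) j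
        · simpa using ha
        · simpa using hb j
      · simp [Fin.sum_univ_castSucc]
      · simp [monomial_mul]
    · rintro ⟨_, ⟨b, hb, rfl⟩, rfl⟩
      refine ⟨_, ⟨_, ⟨fun j => b j.castSucc, fun j => hb _, rfl⟩, rfl⟩, _,
        ⟨b (Fin.last m), hb _, rfl⟩, ?_⟩
      simp [monomial_mul, Fin.sum_univ_castSucc]

theorem exists_mem_support_of_notMem {P : Ideal (MvPolynomial σ K)}
    {s : MvPolynomial σ K} (hs : s ∉ P) :
    ∃ c ∈ s.support, ∀ i, X i ∈ P → c i = 0 := by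
  by_contra! h
  refine hs (mem_of_forall_monomial_mem fun c hc => ?_)
  obtain ⟨i, hi, hci⟩ := h c hc
  refine monomial_mem_of_le (a := Finsupp.single i 1) ?_ hi
  rw [Finsupp.single_le_iff]
  omega

theorem monomial_notMem {P : Ideal (MvPolynomial σ K)} [hP : P.IsPrime] {c : σ →₀ ℕ}
    (hc : ∀ i, X i ∈ P → c i = 0) : monomial c (1 : K) ∉ P := by
  intro h
  rw [monomial_eq, C_1, one_mul, Finsupp.prod, hP.prod_mem_iff] at h
  obtain ⟨i, hi, hmem⟩ := h
  exact Finsupp.mem_support_iff.mp hi (hc i (hP.mem_of_pow_mem _ hmem))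

theorem monomial_mem_localContraction_of_add {J P : Ideal (MvPolynomial σ K)} [P.IsPrime]
    {a c : σ →₀ ℕ} (hc : ∀ i, X i ∈ P → c i = 0) (h : monomial (a + c) (1 : K) ∈ J) :
    monomial a (1 : K) ∈ localContraction J P :=
  mem_localContraction.mpr ⟨monomial c 1, monomial_notMem hc, by
    rwa [monomial_mul, one_mul, add_comm]⟩

/-- Membership in `R ∩ J R_P` only depends on the exponents of the variables in `P`. -/
theorem monomial_mem_localContraction_of_le {J P : Ideal (MvPolynomial σ K)} [P.IsPrime]
    {a b : σ →₀ ℕ} (hab : ∀ i, X i ∈ P → b i ≤ a i) (h : monomial b (1 : K) ∈ J) :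
    monomial a (1 : K) ∈ localContraction J P := by
  refine monomial_mem_localContraction_of_add (c := b - a) (fun i hi => ?_)
    (monomial_mem_of_le (fun i => ?_) h)
  · have := hab i hi
    simp only [Finsupp.tsub_apply]
    omega
  · simp only [Finsupp.add_apply, Finsupp.tsub_apply]
    omega

/-- A denominator `s ∉ P` has a monomial `x^c` free of the variables of `P`, and `x^(c+a)` survives
in `s x^a`. -/
theorem exists_of_monomial_mem_localContraction {S : Set (σ →₀ ℕ)}
    {P : Ideal (MvPolynomial σ K)} [P.IsPrime] {a : σ →₀ ℕ}
    (h : monomial a (1 : K) ∈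
      localContraction (Ideal.span ((fun a => monomial a (1 : K)) '' S)) P) :
    ∃ b ∈ S, ∀ i, X i ∈ P → b i ≤ a i := by
  obtain ⟨s, hs, hsa⟩ := mem_localContraction.mp h
  obtain ⟨c, hc, hcP⟩ := exists_mem_support_of_notMem hs
  obtain ⟨b, hb, hle⟩ := mem_ideal_span_monomial_image.mp hsa (c + a) (by
    rw [mem_support_iff, coeff_mul_monomial, mul_one]
    exact mem_support_iff.mp hc)
  refine ⟨b, hb, fun i hi => ?_⟩
  have := hle i
  rwa [Finsupp.add_apply, hcP i hi, zero_add] at this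

/-- Grade by the degree `w` in the variables of `P`. The lowest-weight parts of `s` (weight zero)
and of `f` contain exponents `c`, `b` whose sum arises only once, so `x^(c+b)` does not cancel in `s
f`. -/
theorem exists_mem_support_monomial_mem_localContraction [Finite σ] {S : Set (σ →₀ ℕ)}
    {P : Ideal (MvPolynomial σ K)} [P.IsPrime] {f : MvPolynomial σ K}
    (h : f ∈ localContraction (Ideal.span ((fun a => monomial a (1 : K)) '' S)) P)
    (hf : f ≠ 0) :
    ∃ b ∈ f.support, monomial b (1 : K) ∈
      localContraction (Ideal.span ((fun a => monomial a (1 : K)) '' S)) P := by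
  classical
  have := Fintype.ofFinite σ
  obtain ⟨s, hs, hsf⟩ := mem_localContraction.mp h
  let w : (σ →₀ ℕ) → ℕ := fun a => ∑ i with X i ∈ P, a i
  have hw : ∀ a b, w (a + b) = w a + w b := fun a b => by
    simp [w, Finset.sum_add_distrib]
  have hw0 : ∀ a, w a = 0 ↔ ∀ i, X i ∈ P → a i = 0 := fun a => by
    simp [w, Finset.sum_eq_zero_iff]
  obtain ⟨c₀, hc₀, hc₀P⟩ := exists_mem_support_of_notMem hs
  obtain ⟨b₀, hb₀, hmin⟩ := Finset.exists_min_image f.support w (support_nonempty.mpr hf)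
  obtain ⟨c, hc, b, hb, huniq⟩ := UniqueSums.uniqueAdd_of_nonempty
    (A := s.support.filter fun c => w c = 0) (B := f.support.filter fun b => w b = w b₀)
    ⟨c₀, by rw [Finset.mem_filter]; exact ⟨hc₀, (hw0 _).mpr hc₀P⟩⟩
    ⟨b₀, by rw [Finset.mem_filter]; exact ⟨hb₀, rfl⟩⟩
  rw [Finset.mem_filter] at hc hb
  have hcoeff : coeff (c + b) (s * f) = coeff c s * coeff b f := by
    rw [coeff_mul]
    refine Finset.sum_eq_single (c, b) ?_ (by simp)
    rintro ⟨x, y⟩ hxy hne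
    rw [Finset.HasAntidiagonal.mem_antidiagonal] at hxy
    by_contra hprod
    have hx : x ∈ s.support := mem_support_iff.mpr (left_ne_zero_of_mul hprod)
    have hy : y ∈ f.support := mem_support_iff.mpr (right_ne_zero_of_mul hprod)
    have h1 := congrArg w hxy
    simp only [hw] at h1
    have h2 := hmin y hy
    obtain ⟨rfl, rfl⟩ := huniq (a := x) (b := y) (by rw [Finset.mem_filter]; exact ⟨hx, by omega⟩)
      (by rw [Finset.mem_filter]; exact ⟨hy, by omega⟩) hxy
    exact hne rfl
  refine ⟨b, hb.1, monomial_mem_localContraction_of_add (c := c) ((hw0 c).mp hc.2) ?_⟩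
  rw [add_comm]
  refine monomial_mem_span_of_mem_support hsf (mem_support_iff.mpr ?_)
  rw [hcoeff]
  exact mul_ne_zero (mem_support_iff.mp hc.1) (mem_support_iff.mp hb.1)

/-- The contraction `R ∩ J R_P` of a monomial ideal `J` is a monomial ideal. -/
theorem monomial_mem_localContraction_of_mem_support [Finite σ] {S : Set (σ →₀ ℕ)}
    {P : Ideal (MvPolynomial σ K)} [P.IsPrime] {f : MvPolynomial σ K}
    (h : f ∈ localContraction (Ideal.span ((fun a => monomial a (1 : K)) '' S)) P)
    {a : σ →₀ ℕ} (ha : a ∈ f.support) :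
    monomial a (1 : K) ∈
      localContraction (Ideal.span ((fun a => monomial a (1 : K)) '' S)) P := by
  classical
  induction hk : f.support.card generalizing f with
  | zero =>
    rw [Finset.card_eq_zero] at hk
    simp [hk] at ha
  | succ k ih =>
    obtain ⟨b, hb, hbJ⟩ := exists_mem_support_monomial_mem_localContraction h (by
      rintro rfl
      simp at ha)
    by_cases hab : a = b
    · rwa [hab]
    have hsupp : (f - monomial b (coeff b f)).support = f.support.erase b := by
      ext x
      rw [mem_support_iff, coeff_sub, coeff_monomial, Finset.mem_erase, mem_support_iff]
      by_cases hx : b = x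
      · simp [hx]
      · simp [hx, Ne.symm hx]
    -- Removing the term already known to lie in the contraction leaves an element of it with one
    -- term fewer.
    refine ih (f := f - monomial b (coeff b f)) (Ideal.sub_mem _ h ?_) ?_ ?_
    · have := Ideal.mul_mem_left _ (C (coeff b f)) hbJ
      rwa [C_mul_monomial, mul_one] at this
    · rw [hsupp]
      exact Finset.mem_erase.mpr ⟨hab, ha⟩
    · rw [hsupp, Finset.card_erase_of_mem hb]
      omega

end Monomials

end MonomialSymbolic

namespace MonomialSymbolic

/-! ### Containment of symbolic powers in ordinary powers -/

section Powers

open MvPolynomial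

variable {σ K : Type*} [Field K]

theorem exists_of_monomial_mem_localContraction_pow {S : Set (σ →₀ ℕ)} {m : ℕ}
    {P : Ideal (MvPolynomial σ K)} [P.IsPrime] {a : σ →₀ ℕ}
    (h : monomial a (1 : K) ∈
      localContraction (Ideal.span ((fun a => monomial a (1 : K)) '' S) ^ m) P) :
    ∃ b : Fin m → σ →₀ ℕ, (∀ j, b j ∈ S) ∧ ∀ i, X i ∈ P → ∑ j, b j i ≤ a i := by
  rw [span_monomial_pow] at h
  obtain ⟨_, ⟨b, hb, rfl⟩, hle⟩ := exists_of_monomial_mem_localContraction h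
  exact ⟨b, hb, fun i hi => by simpa using hle i hi⟩

theorem exists_X_mem {S : Set (σ →₀ ℕ)} (hS : S.Nonempty)
    {P : Ideal (MvPolynomial σ K)} [hP : P.IsPrime]
    (h : Ideal.span ((fun a => monomial a (1 : K)) '' S) ≤ P) : ∃ i, X i ∈ P := by
  obtain ⟨a, ha⟩ := hS
  by_contra! hX
  exact monomial_notMem (P := P) (c := a) (fun i hi => absurd hi (hX i))
    (h (Ideal.subset_span ⟨a, ha, rfl⟩))

/-- If `x^a` lies in `I^m R_P`, where `m` is at least `r` times the height of `P`, then
some element of `I R_P` has an `r`-th power dividing `x^a`. -/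
theorem monomial_div_mem_localContraction [Finite σ] {S : Set (σ →₀ ℕ)} (hS : S.Nonempty)
    {P : Ideal (MvPolynomial σ K)} [P.IsPrime]
    (hSP : Ideal.span ((fun a => monomial a (1 : K)) '' S) ≤ P) {e r m : ℕ}
    (he : P.height ≤ e) (hr : 0 < r) (hm : e * r ≤ m) {a : σ →₀ ℕ}
    (h : monomial a (1 : K) ∈
      localContraction (Ideal.span ((fun a => monomial a (1 : K)) '' S) ^ m) P) :
    monomial (a.mapRange (· / r) (Nat.zero_div r)) (1 : K) ∈
      localContraction (Ideal.span ((fun a => monomial a (1 : K)) '' S)) P := by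
  classical
  have := Fintype.ofFinite σ
  obtain ⟨b, hb, hle⟩ := exists_of_monomial_mem_localContraction_pow h
  have hcard : Fintype.card {i : σ // X i ∈ P} ≤ e := by
    have h1 := card_le_height_of_X_mem (Finset.univ.filter fun i => X i ∈ P) P (by simp)
    rw [Fintype.card_subtype]
    exact_mod_cast h1.trans he
  -- `P` contains a variable, which forces `e ≥ 1`.
  have hm0 : 0 < m := by
    obtain ⟨i, hi⟩ := exists_X_mem hS hSP
    have : 0 < Fintype.card {i : σ // X i ∈ P} := Fintype.card_pos_iff.mpr ⟨⟨i, hi⟩⟩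
    exact lt_of_lt_of_le (Nat.mul_pos (this.trans_le hcard) hr) hm
  have hmR : (0 : ℝ) < m := by exact_mod_cast hm0
  -- Equal weights `1/m`, keeping only the coordinates of variables in `P`.
  obtain ⟨j, -, hj⟩ := exists_le_card_mul_sum
    (fun (j : Fin m) (i : {i : σ // X i ∈ P}) => (b j i : ℝ)) Finset.univ (fun _ => 1 / (m : ℝ))
    (fun _ _ _ => Nat.cast_nonneg _) (fun _ _ => by positivity) (by simp [hmR.ne'])
  refine monomial_mem_localContraction_of_le (b := b j) (fun i hi => ?_)
    (Ideal.subset_span ⟨b j, hb j, rfl⟩)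
  rw [Finsupp.mapRange_apply, Nat.le_div_iff_mul_le hr]
  have h1 := hj ⟨i, hi⟩
  rw [← Finset.mul_sum] at h1
  have h2 : (∑ l, (b l i : ℝ)) ≤ a i := by exact_mod_cast hle i hi
  have h3 : (Fintype.card {i : σ // X i ∈ P} : ℝ) * r ≤ m := by
    exact_mod_cast (Nat.mul_le_mul_right r hcard).trans hm
  have h4 : (b j i : ℝ) * r ≤ a i := by
    have h5 : (0 : ℝ) ≤ a i := Nat.cast_nonneg _
    calc (b j i : ℝ) * r
        ≤ (Fintype.card {i : σ // X i ∈ P} * (1 / (m : ℝ) * ∑ l, (b l i : ℝ))) * r := by gcongr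
      _ = (Fintype.card {i : σ // X i ∈ P} * r) / (m : ℝ) * ∑ l, (b l i : ℝ) := by ring
      _ ≤ (Fintype.card {i : σ // X i ∈ P} * r) / (m : ℝ) * a i := by gcongr
      _ ≤ 1 * a i := by
        gcongr
        exact (div_le_one hmR).mpr h3
      _ = a i := one_mul _
  exact_mod_cast h4

theorem height_le_of_bigHeight_eq {R : Type*} [CommRing R] {I : Ideal R} {e : ℕ}
    (he : bigHeight I = e) {P : Ideal R} (hP : P ∈ associatedPrimes R (R ⧸ I)) :
    P.height ≤ e := by
  rw [← he, bigHeight]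
  exact le_iSup₂ (f := fun (P : Ideal R) (_ : P ∈ associatedPrimes R (R ⧸ I)) => P.height) P hP

theorem mem_symbolicPower {R : Type*} [CommRing R] {I : Ideal R} {m : ℕ} {f : R} :
    f ∈ symbolicPower I m ↔ ∀ P : associatedPrimes R (R ⧸ I),
      haveI : P.1.IsPrime := P.2.isPrime
      f ∈ localContraction (I ^ m) P.1 := by
  rw [symbolicPower, Ideal.mem_iInf]

/-- The symbolic powers of a monomial ideal are monomial ideals. -/
theorem monomial_mem_symbolicPower_of_mem_support [Finite σ] {S : Set (σ →₀ ℕ)} {m : ℕ}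
    {f : MvPolynomial σ K}
    (hf : f ∈ symbolicPower (Ideal.span ((fun a => monomial a (1 : K)) '' S)) m)
    {a : σ →₀ ℕ} (ha : a ∈ f.support) :
    monomial a (1 : K) ∈ symbolicPower (Ideal.span ((fun a => monomial a (1 : K)) '' S)) m := by
  rw [mem_symbolicPower] at hf ⊢
  intro P
  have : P.1.IsPrime := P.2.isPrime
  have h := hf P
  rw [span_monomial_pow] at h ⊢
  exact monomial_mem_localContraction_of_mem_support h ha

/-- For monomial ideals, `I^{(m)} ⊆ I^r` for `m ≥ e r`, where `e` is the big-height of `I`. -/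
theorem monomial_mem_pow_of_mem_symbolicPower [Finite σ] {S : Set (σ →₀ ℕ)} (hS : S.Nonempty)
    {e r m : ℕ} (he : bigHeight (Ideal.span ((fun a => monomial a (1 : K)) '' S)) = e)
    (hm : e * r ≤ m) {a : σ →₀ ℕ}
    (h : monomial a (1 : K) ∈
      symbolicPower (Ideal.span ((fun a => monomial a (1 : K)) '' S)) m) :
    monomial a (1 : K) ∈ Ideal.span ((fun a => monomial a (1 : K)) '' S) ^ r := by
  rcases Nat.eq_zero_or_pos r with rfl | hr
  · simp
  rw [mem_symbolicPower] at h
  have hmem : monomial (a.mapRange (· / r) (Nat.zero_div r)) (1 : K) ∈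
      Ideal.span ((fun a => monomial a (1 : K)) '' S) := by
    refine mem_of_forall_mem_localContraction fun P => ?_
    have : P.1.IsPrime := P.2.isPrime
    exact monomial_div_mem_localContraction hS (le_of_mem_associatedPrimes P.2)
      (height_le_of_bigHeight_eq he P.2) hr hm (h P)
  have hpow := Ideal.pow_mem_pow hmem r
  rw [monomial_pow, one_pow] at hpow
  refine monomial_mem_of_le (fun i => ?_) hpow
  simpa using Nat.mul_div_le (a i) r

end Powers

/-! ### The symbolic polyhedron, `α` and `β` -/

section Polyhedron

open MvPolynomial
open scoped Pointwise

variable {K : Type*} [Field K] {n : ℕ}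

/-- The lattice orthant is a product, and convex hulls commute with products. -/
theorem mem_convexHull_nat_points {ι : Type*} [Finite ι] {y : ι → ℝ} (hy : 0 ≤ y) :
    y ∈ convexHull ℝ {v : ι → ℝ | ∃ c : ι →₀ ℕ, v = fun i => (c i : ℝ)} := by
  have hset : {v : ι → ℝ | ∃ c : ι →₀ ℕ, v = fun i => (c i : ℝ)} =
      Set.univ.pi fun _ => Set.range ((↑) : ℕ → ℝ) := by
    ext v
    simp only [Set.mem_ofPred_eq, Set.mem_pi, Set.mem_univ, Set.mem_range, true_imp_iff]
    constructor
    · rintro ⟨c, rfl⟩ i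
      exact ⟨c i, rfl⟩
    · intro h
      choose c hc using h
      exact ⟨Finsupp.equivFunOnFinite.symm c, funext fun i => by simp [hc]⟩
  rw [hset, convexHull_pi]
  intro i _
  obtain ⟨k, hk⟩ := exists_nat_ge (y i)
  refine segment_subset_convexHull (Set.mem_range_self 0) (Set.mem_range_self k) ?_
  rw [Nat.cast_zero, segment_eq_Icc (Nat.cast_nonneg k)]
  exact ⟨hy i, hk⟩

theorem mem_convexHull_latticePoints_of_le {J : Ideal (MvPolynomial (Fin (n + 1)) K)}
    {x y : Fin (n + 1) → ℝ} (hx : x ∈ convexHull ℝ (latticePoints J)) (hxy : x ≤ y) :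
    y ∈ convexHull ℝ (latticePoints J) := by
  have h := Set.add_mem_add hx (mem_convexHull_nat_points (sub_nonneg.mpr hxy))
  rw [← convexHull_add, add_sub_cancel] at h
  refine convexHull_mono ?_ h
  rintro _ ⟨_, ⟨a, ha, rfl⟩, _, ⟨c, rfl⟩, rfl⟩
  exact ⟨a + c, monomial_mem_of_le le_self_add ha, funext fun i => by simp⟩

/-- Dickson's lemma. -/
theorem finite_minimal_monomials (J : Ideal (MvPolynomial (Fin (n + 1)) K)) :
    {a : Fin (n + 1) →₀ ℕ | Minimal (fun b => monomial b (1 : K) ∈ J) a}.Finite :=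
  WellQuasiOrderedLE.finite_of_isAntichain (setOfPred_minimal_antichain _)

theorem exists_minimal_monomial_le {J : Ideal (MvPolynomial (Fin (n + 1)) K)}
    {a : Fin (n + 1) →₀ ℕ} (ha : monomial a (1 : K) ∈ J) :
    ∃ g ≤ a, Minimal (fun b => monomial b (1 : K) ∈ J) g :=
  exists_minimal_le_of_wellFoundedLT (fun b => monomial b (1 : K) ∈ J) a ha

/-- The convex hull of the exponents of a monomial ideal is the sum of a polytope and the
nonnegative orthant. -/
theorem convexHull_latticePoints_eq (J : Ideal (MvPolynomial (Fin (n + 1)) K)) :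
    convexHull ℝ (latticePoints J) = convexHull ℝ
      ((fun (a : Fin (n + 1) →₀ ℕ) (i : Fin (n + 1)) => (a i : ℝ)) ''
        {a | Minimal (fun b => monomial b (1 : K) ∈ J) a}) + Set.Ici 0 := by
  apply Set.Subset.antisymm
  · refine convexHull_min ?_ ((convex_convexHull ℝ _).add (convex_Ici 0))
    rintro _ ⟨a, ha, rfl⟩
    obtain ⟨g, hga, hg⟩ := exists_minimal_monomial_le ha
    refine ⟨_, subset_convexHull ℝ _ ⟨g, hg, rfl⟩, (fun i => (a i : ℝ)) - fun i => (g i : ℝ),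
      ?_, by simp⟩
    rw [Set.mem_Ici, sub_nonneg]
    exact fun i => Nat.cast_le.mpr (hga i)
  · rintro _ ⟨x, hx, y, hy, rfl⟩
    refine mem_convexHull_latticePoints_of_le (convexHull_mono ?_ hx) (le_add_of_nonneg_right hy)
    rintro _ ⟨a, ha, rfl⟩
    exact ⟨a, (Set.mem_ofPred.mp ha).prop, rfl⟩

theorem isClosed_convexHull_latticePoints (J : Ideal (MvPolynomial (Fin (n + 1)) K)) :
    IsClosed (convexHull ℝ (latticePoints J)) := by
  rw [convexHull_latticePoints_eq]
  exact isClosed_Ici.add_left_of_isCompact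
    (((finite_minimal_monomials J).image _).isCompact_convexHull ℝ)

theorem isClosed_symbolicPolyhedron (I : Ideal (MvPolynomial (Fin (n + 1)) K)) :
    IsClosed (symbolicPolyhedron I) :=
  isClosed_iInter fun _ => isClosed_iInter fun _ => isClosed_convexHull_latticePoints _

theorem convexHull_latticePoints_subset_symbolicPolyhedron
    (I : Ideal (MvPolynomial (Fin (n + 1)) K)) :
    convexHull ℝ (latticePoints I) ⊆ symbolicPolyhedron I := by
  refine Set.subset_iInter fun P => Set.subset_iInter fun _ => convexHull_mono ?_
  have : P.1.IsPrime := P.2.isPrime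
  rintro _ ⟨a, ha, rfl⟩
  exact ⟨a, le_localContraction I P.1 ha, rfl⟩

theorem exists_mem_maxAss {R : Type*} [CommRing R] [IsNoetherianRing R] {I : Ideal R}
    (htop : I ≠ ⊤) : ∃ P, P ∈ maxAss I := by
  have : Nontrivial (R ⧸ I) := Ideal.Quotient.nontrivial_iff.mpr htop
  obtain ⟨P, hP⟩ := associatedPrimes.nonempty R (R ⧸ I)
  obtain ⟨Q, -, hQ⟩ := exists_maximal_ge_of_wellFoundedGT
    (fun P => P ∈ associatedPrimes R (R ⧸ I)) P hP
  exact ⟨Q, hQ⟩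

/-- A proper ideal omits the exponent `0`. This is the source of `α(𝒬) > 0`. -/
theorem convexHull_latticePoints_subset_of_ne_top {J : Ideal (MvPolynomial (Fin (n + 1)) K)}
    (hJ : J ≠ ⊤) : convexHull ℝ (latticePoints J) ⊆ {v | 0 ≤ v ∧ 1 ≤ ∑ i, v i} := by
  refine convexHull_min ?_ ((convex_Ici 0).inter
    (convex_halfSpace_ge (f := fun v : Fin (n + 1) → ℝ => ∑ i, v i)
      ⟨fun x y => by simp [Finset.sum_add_distrib], fun c x => by simp [Finset.mul_sum]⟩ 1))
  rintro _ ⟨a, ha, rfl⟩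
  refine ⟨fun i => Nat.cast_nonneg _, ?_⟩
  by_contra hlt
  have h0 : ∑ i, a i = 0 := by
    have : ((∑ i, a i : ℕ) : ℝ) < 1 := by push_cast; exact not_le.mp hlt
    exact Nat.lt_one_iff.mp (by exact_mod_cast this)
  have ha0 : a = 0 := by
    ext i
    exact (Finset.sum_eq_zero_iff.mp h0) i (Finset.mem_univ i)
  subst ha0
  exact hJ ((Ideal.eq_top_iff_one J).mpr (by simpa using ha))

theorem symbolicPolyhedron_subset {I : Ideal (MvPolynomial (Fin (n + 1)) K)} (htop : I ≠ ⊤) :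
    symbolicPolyhedron I ⊆ {v | 0 ≤ v ∧ 1 ≤ ∑ i, v i} := by
  obtain ⟨P, hP⟩ := exists_mem_maxAss htop
  have hPA := hP.prop
  have hPp : P.IsPrime := hPA.isPrime
  refine (Set.iInter₂_subset (⟨P, hPA⟩ : associatedPrimes _ _) hP).trans
    (convexHull_latticePoints_subset_of_ne_top fun h => hPp.ne_top ?_)
  rw [eq_top_iff, ← h]
  exact localContraction_le (le_of_mem_associatedPrimes hPA)

theorem isLeast_alpha {Q : Set (Fin (n + 1) → ℝ)} (hcl : IsClosed Q) (hne : Q.Nonempty)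
    (hQ : Q ⊆ Set.Ici 0) : IsLeast (coordSums Q) (alpha Q) := by
  obtain ⟨v, hv⟩ := hne
  have hle : ∀ u : Fin (n + 1) → ℝ, 0 ≤ u → u ≤ fun _ => ∑ i, u i := fun u hu i =>
    Finset.single_le_sum (f := u) (fun i _ => hu i) (Finset.mem_univ i)
  -- Nonnegative points with coordinate sum at most that of `v` lie in this box, so minimizing there
  -- suffices.
  have hK : IsCompact (Q ∩ Set.Icc 0 fun _ => ∑ i, v i) := isCompact_Icc.inter_left hcl
  obtain ⟨u, hu, hmin⟩ := hK.exists_isMinOn (f := fun u : Fin (n + 1) → ℝ => ∑ i, u i)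
    ⟨v, hv, hQ hv, hle v (hQ hv)⟩ (by fun_prop)
  have hleast : IsLeast (coordSums Q) (∑ i, u i) := by
    refine ⟨⟨u, hu.1, rfl⟩, ?_⟩
    rintro _ ⟨w, hw, rfl⟩
    by_cases hwv : ∑ i, w i ≤ ∑ i, v i
    · exact hmin ⟨hw, hQ hw, (hle w (hQ hw)).trans fun _ => hwv⟩
    · exact (hmin ⟨hv, hQ hv, hle v (hQ hv)⟩ : ∑ i, u i ≤ ∑ i, v i).trans (not_le.mp hwv).le
  rwa [alpha, hleast.csInf_eq]

theorem isGreatest_beta {J : Ideal (MvPolynomial (Fin (n + 1)) K)} {a : Fin (n + 1) →₀ ℕ}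
    (ha : monomial a (1 : K) ∈ J) : IsGreatest (minGenDegrees J) (beta J) := by
  obtain ⟨g, -, hg⟩ := exists_minimal_monomial_le ha
  have hfin : (minGenDegrees J).Finite := (finite_minimal_monomials J).image _
  exact ⟨Nat.sSup_mem ⟨_, g, hg, rfl⟩ hfin.bddAbove, fun _ hx => le_csSup hfin.bddAbove hx⟩

theorem div_mem_convexHull_latticePoints {S : Set (Fin (n + 1) →₀ ℕ)} {m : ℕ} (hm : 0 < m)
    {P : Ideal (MvPolynomial (Fin (n + 1)) K)} [P.IsPrime] {a : Fin (n + 1) →₀ ℕ}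
    (h : monomial a (1 : K) ∈
      localContraction (Ideal.span ((fun a => monomial a (1 : K)) '' S) ^ m) P) :
    (fun i => (a i : ℝ) / m) ∈ convexHull ℝ
      (latticePoints (localContraction (Ideal.span ((fun a => monomial a (1 : K)) '' S)) P)) := by
  classical
  have hmR : (0 : ℝ) < m := by exact_mod_cast hm
  obtain ⟨b, hb, hle⟩ := exists_of_monomial_mem_localContraction_pow h
  -- Exponents of variables outside `P` are set to zero: those variables are units in `R_P`, and the
  -- domination by `a` then holds in every coordinate.
  have hb' : ∀ j, (fun i => ((b j).filter (fun i => X i ∈ P) i : ℝ)) ∈ convexHull ℝ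
      (latticePoints (localContraction (Ideal.span ((fun a => monomial a (1 : K)) '' S)) P)) :=
    fun j => subset_convexHull ℝ _ ⟨_, monomial_mem_localContraction_of_le (b := b j)
      (fun i hi => by rw [Finsupp.filter_apply_pos (fun i => X i ∈ P) _ hi])
      (Ideal.subset_span ⟨_, hb j, rfl⟩), rfl⟩
  have hsum := (convex_convexHull ℝ _).sum_mem (t := Finset.univ)
    (w := fun _ : Fin m => 1 / (m : ℝ)) (fun _ _ => by positivity) (by simp [hmR.ne']) (fun j _ => hb' j)
  refine mem_convexHull_latticePoints_of_le hsum fun i => ?_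
  rw [← Finset.smul_sum, Pi.smul_apply, Finset.sum_apply, smul_eq_mul, one_div_mul_eq_div]
  gcongr
  by_cases hi : X i ∈ P
  · simp only [Finsupp.filter_apply, hi, if_true]
    exact_mod_cast hle i hi
  · simp [hi]

theorem alpha_mul_le_degree {S : Set (Fin (n + 1) →₀ ℕ)} {m : ℕ}
    (hα : IsLeast (coordSums (symbolicPolyhedron
      (Ideal.span ((fun a => monomial a (1 : K)) '' S))))
      (alpha (symbolicPolyhedron (Ideal.span ((fun a => monomial a (1 : K)) '' S)))))
    {a : Fin (n + 1) →₀ ℕ}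
    (h : monomial a (1 : K) ∈
      symbolicPower (Ideal.span ((fun a => monomial a (1 : K)) '' S)) m) :
    alpha (symbolicPolyhedron (Ideal.span ((fun a => monomial a (1 : K)) '' S))) * m ≤
      a.degree := by
  rcases Nat.eq_zero_or_pos m with rfl | hm
  · simp
  have hmR : (0 : ℝ) < m := by exact_mod_cast hm
  rw [mem_symbolicPower] at h
  have hmem : (fun i => (a i : ℝ) / m) ∈
      symbolicPolyhedron (Ideal.span ((fun a => monomial a (1 : K)) '' S)) := by
    refine Set.mem_iInter₂.mpr fun P _ => ?_
    have : P.1.IsPrime := P.2.isPrime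
    exact div_mem_convexHull_latticePoints hm (h P)
  have := hα.2 ⟨_, hmem, rfl⟩
  beta_reduce at this
  rw [← Finset.sum_div, le_div_iff₀ hmR] at this
  rw [Finsupp.degree_eq_sum]
  push_cast
  exact this

end Polyhedron

/-! ### Splitting off powers of `𝔪`, and the main theorem -/

theorem exists_monomial_mem_pow {K : Type*} [Field K] {n : ℕ} {S : Set (Fin (n + 1) →₀ ℕ)}
    (hS : S.Nonempty) (r : ℕ) : ∃ a, MvPolynomial.monomial a (1 : K) ∈
      Ideal.span ((fun a => MvPolynomial.monomial a (1 : K)) '' S) ^ r := by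
  obtain ⟨a, ha⟩ := hS
  have := Ideal.pow_mem_pow (Ideal.subset_span
    (Set.mem_image_of_mem (fun a => MvPolynomial.monomial a (1 : K)) ha)) r
  exact ⟨r • a, by rwa [MvPolynomial.monomial_pow, one_pow] at this⟩

/-- A monomial of degree at least `s + β(J)` in `J` lies in `𝔪^s J`. -/
theorem monomial_mem_pow_mul {K : Type*} [Field K] {n s : ℕ}
    {J : Ideal (MvPolynomial (Fin (n + 1)) K)} {a : Fin (n + 1) →₀ ℕ}
    (ha : MvPolynomial.monomial a (1 : K) ∈ J) (hs : s + beta J ≤ a.degree) :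
    MvPolynomial.monomial a (1 : K) ∈ MvPolynomial.idealOfVars (Fin (n + 1)) K ^ s * J := by
  obtain ⟨g, hga, hg⟩ := exists_minimal_monomial_le ha
  obtain ⟨c, rfl⟩ := exists_add_of_le hga
  have hdeg : g.degree ≤ beta J := (isGreatest_beta ha).2 ⟨g, hg, rfl⟩
  rw [map_add] at hs
  have hmul := Ideal.mul_mem_mul
    ((MvPolynomial.monomial_mem_pow_idealOfVars_iff s c (one_ne_zero (α := K))).mpr (by omega))
    hg.prop
  rwa [MvPolynomial.monomial_mul, one_mul, add_comm c g] at hmul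

end MonomialSymbolic

open MonomialSymbolic in
theorem mainTheorem6 {K : Type*} [Field K] (n : ℕ)
    (I : Ideal (MvPolynomial (Fin (n + 1)) K))
    (hmon : MonomialSymbolic.IsMonomialIdeal I) (hbot : I ≠ ⊥) (htop : I ≠ ⊤)
    (e : ℕ) (he : MonomialSymbolic.bigHeight I = (e : ℕ∞)) :
    -- the extrema `α(𝒬)` and `β(I^r)` are attained, and `α(𝒬)` is positive
    IsLeast (MonomialSymbolic.coordSums (MonomialSymbolic.symbolicPolyhedron I))
      (MonomialSymbolic.alpha (MonomialSymbolic.symbolicPolyhedron I)) ∧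
    0 < MonomialSymbolic.alpha (MonomialSymbolic.symbolicPolyhedron I) ∧
    (∀ r : ℕ, IsGreatest (MonomialSymbolic.minGenDegrees (I ^ r))
      (MonomialSymbolic.beta (I ^ r))) ∧
    ∀ r m : ℕ,
      max ((e : ℝ) * (r : ℝ))
        ((MonomialSymbolic.beta (I ^ r) : ℝ) /
          MonomialSymbolic.alpha (MonomialSymbolic.symbolicPolyhedron I)) ≤ (m : ℝ) →
      ∃ s : ℕ,
        (s : ℤ) = ⌈MonomialSymbolic.alpha (MonomialSymbolic.symbolicPolyhedron I) * (m : ℝ)⌉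
          - (MonomialSymbolic.beta (I ^ r) : ℤ) ∧
        MonomialSymbolic.symbolicPower I m ≤
          MvPolynomial.idealOfVars (Fin (n + 1)) K ^ s * I ^ r := by
  obtain ⟨S, rfl⟩ := hmon
  have hS : S.Nonempty := by
    rw [Set.nonempty_iff_ne_empty]
    rintro rfl
    simp at hbot
  have hsub := symbolicPolyhedron_subset htop
  have hne : (symbolicPolyhedron
      (Ideal.span ((fun a => MvPolynomial.monomial a (1 : K)) '' S))).Nonempty := by
    obtain ⟨a, ha⟩ := hS
    exact ⟨_, convexHull_latticePoints_subset_symbolicPolyhedron _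
      (subset_convexHull ℝ _ ⟨a, Ideal.subset_span ⟨a, ha, rfl⟩, rfl⟩)⟩
  have hα := isLeast_alpha (isClosed_symbolicPolyhedron _) hne fun v hv => (hsub hv).1
  have hpos : 0 < alpha (symbolicPolyhedron
      (Ideal.span ((fun a => MvPolynomial.monomial a (1 : K)) '' S))) := by
    obtain ⟨v, hv, hsum⟩ := hα.1
    rw [← hsum]
    exact zero_lt_one.trans_le (hsub hv).2
  refine ⟨hα, hpos, fun r => ?_, fun r m hm => ?_⟩
  · obtain ⟨a, ha⟩ := exists_monomial_mem_pow (K := K) hS r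
    exact isGreatest_beta ha
  rw [max_le_iff, div_le_iff₀' hpos] at hm
  obtain ⟨her, hβ⟩ := hm
  -- The bound `m ≥ β(I^r)/α(𝒬)` is what makes the exponent of `𝔪` a natural number.
  have hnonneg : 0 ≤ ⌈alpha (symbolicPolyhedron
      (Ideal.span ((fun a => MvPolynomial.monomial a (1 : K)) '' S))) * (m : ℝ)⌉ -
      (beta (Ideal.span ((fun a => MvPolynomial.monomial a (1 : K)) '' S) ^ r) : ℤ) := by
    rw [sub_nonneg]
    exact_mod_cast hβ.trans (Int.le_ceil _)
  obtain ⟨s, hs⟩ := Int.eq_ofNat_of_zero_le hnonneg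
  refine ⟨s, hs.symm, fun f hf => mem_of_forall_monomial_mem fun a ha => ?_⟩
  have hmem := monomial_mem_symbolicPower_of_mem_support hf ha
  refine monomial_mem_pow_mul
    (monomial_mem_pow_of_mem_symbolicPower hS he (by exact_mod_cast her) hmem) ?_
  have hceil : ⌈alpha (symbolicPolyhedron
      (Ideal.span ((fun a => MvPolynomial.monomial a (1 : K)) '' S))) * (m : ℝ)⌉ ≤ a.degree :=
    Int.ceil_le.mpr (by exact_mod_cast alpha_mul_le_degree hα hmem)
  omega
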